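/- Let $H$ and $L$ be profinite groups with a common closed subgroup $K$ (that is, a profinite group $K$ with continuous injective homomorphisms $K \to H$ and $K \to L$), and let $G = H \amalg_K L$ be the profinite amalgamated product, i.e. the pushout of $H \leftarrow K \to L$ in the category of profinite groups. Write $\overline{H}$, $\overline{L}$ and $\overline{K}$ for the images of $H$, $L$ and $K$ in $G$ under the canonical morphisms (which are simply $H$, $L$ and $K$ when these morphisms are injective). Then $\overline{H}$ and $\overline{L}$ are malnormal relative to $\overline{K}$ in $G$: for $\Delta \in \{\overline{H}, \overline{L}\}$ we have $\overline{K} \le \Delta$, and for every $g \in G - \Delta$ there is $h \in \Delta$ such that $$\Delta \cap \Delta^g \leq \overline{K}^h,$$ where $X^g = g^{-1} X g$ denotes the conjugate of a subgroup $X \le G$ by $g \in G$. -/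

import Mathlib

open CategoryTheory

universe u

namespace ProfiniteAmalgam

/-- The conjugate `D ^ g = g⁻¹ D g` of a subgroup `D` of `Γ`. -/
def conjBy {Γ : Type*} [Group Γ] (D : Subgroup Γ) (g : Γ) : Subgroup Γ :=
  D.map (MulAut.conj g⁻¹).toMonoidHom

theorem mem_conjBy {Γ : Type*} [Group Γ] (D : Subgroup Γ) (g x : Γ) :
    x ∈ conjBy D g ↔ ∃ d ∈ D, g⁻¹ * d * g = x := by
  simp [conjBy, Subgroup.mem_map]

/-- For subgroups `X ≤ D ≤ Γ`: the subgroup `D` is malnormal relative to `X` in `Γ`, that is,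
for each `g ∈ Γ - D` there is `h ∈ D` with `D ∩ D ^ g ≤ X ^ h`. -/
def IsMalnormalRelativeTo {Γ : Type*} [Group Γ] (D X : Subgroup Γ) : Prop :=
  X ≤ D ∧ ∀ g : Γ, g ∉ D → ∃ h ∈ D, D ⊓ conjBy D g ≤ conjBy X h

/-- The image of a morphism of profinite groups, as a subgroup of its target. -/
def image {A B : ProfiniteGrp.{u}} (f : A ⟶ B) : Subgroup B :=
  f.hom.toMonoidHom.range

/-- `G` is the profinite amalgamated product `H ∐_K L`: the group `K` is a common (closed)
subgroup of the profinite groups `H` and `L` via the embeddings `iH` and `iL`, and `G`, with the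
canonical morphisms `jH` and `jL`, is the pushout in the category of profinite groups.
The canonical morphisms `jH` and `jL` need not be injective. -/
structure IsAmalgamatedProduct {K H L G : ProfiniteGrp.{u}}
    (iH : K ⟶ H) (iL : K ⟶ L) (jH : H ⟶ G) (jL : L ⟶ G) : Prop where
  injective_left : Function.Injective iH
  injective_right : Function.Injective iL
  isPushout : IsPushout iH iL jH jL

end ProfiniteAmalgam

/-! Write H, L, K for the images in G. G acts on the graph with vertices G/H ⊔ G/L and edges G/K,
where xK joins xH to xL. The pushout property makes it a profinite tree
(`hasStandardTree_of_isPushout`): it is connected, and every locally constant function on edges is a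
coboundary. Splitting the delta functions of edges gives, modulo an open normal U, a chain joining
any two H-vertices.

If `a` fixes two H-vertices and has p-power order modulo U, it preserves their chain over ℤ/p, and
the edges it moves form orbits of size divisible by p. Hence the edges fixed modulo U already
connect the two vertices (`apply_eq_of_pow_mem`).

H ∩ H^g is the stabilizer of the vertices H and g⁻¹H. Their chain contains an edge at H, and each
element of the stabilizer fixes that edge modulo U (`exists_conj_mem_sup`). Compactness yields an
edge hK with h ∈ H that the whole intersection fixes. The case of L follows by symmetry. -/

namespace ProfiniteAmalgam

/-! ### Functions on cosets and counting modulo p. -/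

section Abstract

variable {G : Type u} [Group G]

/-- A function on a group that is constant on the left cosets of the subgroup `B`. -/
def RightInvariant {S : Type*} (B : Subgroup G) (f : G → S) : Prop :=
  ∀ x, ∀ b ∈ B, f (x * b) = f x

theorem RightInvariant.mono {S : Type*} {B C : Subgroup G} {f : G → S}
    (hf : RightInvariant C f) (h : B ≤ C) : RightInvariant B f :=
  fun x b hb => hf x b (h hb)

theorem RightInvariant.comp {S T : Type*} {B : Subgroup G} {f : G → S}
    (hf : RightInvariant B f) (φ : S → T) : RightInvariant B (fun x => φ (f x)) :=
  fun x b hb => congrArg φ (hf x b hb)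

theorem RightInvariant.map₂ {S T R : Type*} {B : Subgroup G} {f : G → S} {f' : G → T}
    (hf : RightInvariant B f) (hf' : RightInvariant B f') (φ : S → T → R) :
    RightInvariant B (fun x => φ (f x) (f' x)) :=
  fun x b hb => by simp only [hf x b hb, hf' x b hb]

theorem RightInvariant.mul_left {S : Type*} {B : Subgroup G} {f : G → S}
    (hf : RightInvariant B f) (a : G) : RightInvariant B (fun x => f (a * x)) :=
  fun x b hb => by simpa only [mul_assoc] using hf (a * x) b hb

/-- The right translations that preserve a function. -/
def period {S : Type*} (f : G → S) : Subgroup G where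
  carrier := {y | ∀ x, f (x * y) = f x}
  one_mem' x := by simp
  mul_mem' {y z} hy hz x := by rw [← mul_assoc, hz, hy]
  inv_mem' {y} hy x := by simpa using (hy (x * y⁻¹)).symm

theorem rightInvariant_iff_le_period {S : Type*} {B : Subgroup G} {f : G → S} :
    RightInvariant B f ↔ B ≤ period f :=
  ⟨fun h b hb x => h x b hb, fun h x _ hb => h hb x⟩

theorem RightInvariant.sup {S : Type*} {B C : Subgroup G} {f : G → S}
    (hB : RightInvariant B f) (hC : RightInvariant C f) : RightInvariant (B ⊔ C) f := by
  rw [rightInvariant_iff_le_period] at *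
  exact sup_le hB hC

/-- A function that is constant on left cosets factors through the coset space. -/
theorem RightInvariant.exists_factor {S : Type*} {B : Subgroup G} {f : G → S}
    (hf : RightInvariant B f) : ∃ φ : G ⧸ B → S, ∀ x : G, φ x = f x := by
  refine ⟨fun e => f e.out, fun x => ?_⟩
  obtain ⟨b, hb⟩ := QuotientGroup.mk_out_eq_mul B x
  exact (congrArg f hb).trans (hf x b b.2)

theorem mk_mul_eq_iff (B : Subgroup G) (a x : G) :
    ((a * x : G) : G ⧸ B) = (x : G ⧸ B) ↔ x⁻¹ * a * x ∈ B := by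
  rw [eq_comm, QuotientGroup.eq, mul_assoc]

/-- If a permutation of `p`-power order preserves a function with values in `ℤ/p` that vanishes at
its fixed points, then the values of the function sum to zero. -/
theorem sum_eq_zero_of_perm_pow_eq_one {E : Type*} [Fintype E] {p k : ℕ} [hp : Fact p.Prime]
    (σ : Equiv.Perm E) (hσ : σ ^ p ^ k = 1) (w : E → ZMod p) (hw : ∀ e, w (σ e) = w e)
    (hfix : ∀ e, σ e = e → w e = 0) : ∑ e, w e = 0 := by
  classical
  rw [← Finset.sum_fiberwise Finset.univ w w]
  refine Finset.sum_eq_zero fun s _ => ?_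
  rw [Finset.sum_congr rfl (fun e he => (Finset.mem_filter.1 he).2), Finset.sum_const,
    nsmul_eq_mul]
  rcases eq_or_ne s 0 with rfl | hs
  · simp
  -- Over s ≠ 0 the permutation has no fixed point, so p divides the size of the fiber.
  let τ : Function.End {e // w e = s} := fun e => ⟨σ e, (hw e).trans e.2⟩
  have hτ : ∀ (n : ℕ) (e : {e // w e = s}), ((τ ^ n) e : E) = (σ ^ n) e := by
    intro n
    induction n with
    | zero => intro e; rfl
    | succ n ih =>
      intro e
      rw [pow_succ, pow_succ]
      exact ih (τ e)
  have hτ1 : τ ^ p ^ k = 1 := by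
    funext e
    apply Subtype.ext
    rw [hτ, hσ]
    rfl
  have hcard := Equiv.Perm.card_fixedPoints_modEq hτ1
  have hempty : IsEmpty (Function.fixedPoints τ) :=
    ⟨fun ⟨e, he⟩ => hs (e.2.symm.trans (hfix e (congrArg Subtype.val he)))⟩
  rw [Fintype.card_eq_zero (α := Function.fixedPoints τ), Fintype.card_subtype] at hcard
  rw [(ZMod.natCast_eq_natCast_iff _ _ _).2 hcard]
  simp

/-- An element with a power in `B` lies in `B` if this holds for powers of prime power exponent. -/
theorem mem_of_pow_mem_of_prime_pow {B V : Subgroup G} (n : ℕ) (hn : n ≠ 0) :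
    ∀ a : G, (∀ m p k : ℕ, p.Prime → (a ^ m) ^ p ^ k ∈ V → a ^ m ∈ B) → a ^ n ∈ V → a ∈ B := by
  induction n using Nat.recOnPosPrimePosCoprime with
  | zero => exact absurd rfl hn
  | one =>
    intro a h ha
    have := h 1 2 0 Nat.prime_two (by simpa using ha)
    simpa using this
  | prime_pow p k hp _ =>
    intro a h ha
    have := h 1 p k hp (by simpa using ha)
    simpa using this
  | coprime s t hs ht hst ihs iht =>
    intro a h ha
    have key : ∀ m r : ℕ, r ≠ 0 → (∀ a : G, (∀ m p k : ℕ, p.Prime → (a ^ m) ^ p ^ k ∈ V →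
        a ^ m ∈ B) → a ^ r ∈ V → a ∈ B) → a ^ (m * r) ∈ V → a ^ m ∈ B := by
      intro m r _ ih hm
      refine ih (a ^ m) (fun j p k hp hj => ?_) (by rwa [← pow_mul])
      rw [← pow_mul a m j] at hj ⊢
      exact h _ p k hp hj
    have h1 : a ^ t ∈ B := key t s (by lia) (ihs (by lia)) (by rwa [mul_comm])
    have h2 : a ^ s ∈ B := key s t (by lia) (iht (by lia)) ha
    have hbez : a = (a ^ s) ^ (s.gcdA t) * (a ^ t) ^ (s.gcdB t) := by
      have := Nat.gcd_eq_gcd_ab s t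
      rw [hst.gcd_eq_one] at this
      rw [← zpow_natCast, ← zpow_natCast, ← zpow_mul, ← zpow_mul, ← zpow_add, ← this]
      simp
    rw [hbez]
    exact B.mul_mem (B.zpow_mem h2 _) (B.zpow_mem h1 _)

open Classical in
/-- The characteristic function of a coset, as a function of its representative. -/
noncomputable def delta (p : ℕ) (B : Subgroup G) (x : G) : G ⧸ B → ZMod p :=
  fun e => if (x : G ⧸ B) = e then 1 else 0

theorem rightInvariant_delta (p : ℕ) (B : Subgroup G) : RightInvariant B (delta p B) := by
  intro x b hb
  funext e
  simp only [delta]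
  rw [QuotientGroup.mk_mul_of_mem x hb]

theorem sum_mul_delta {p : ℕ} {B : Subgroup G} [Fintype (G ⧸ B)] (φ : G ⧸ B → ZMod p) (x : G) :
    ∑ e, φ e * delta p B x e = φ x := by
  classical
  simp [delta]

theorem delta_smul (p : ℕ) (B : Subgroup G) (a x : G) (e : G ⧸ B) :
    delta p B (a * x) (a • e) = delta p B x e := by
  classical
  have : ((a * x : G) : G ⧸ B) = a • (x : G ⧸ B) := rfl
  simp only [delta, this, smul_left_cancel_iff]

/-! ### The standard tree and its chains. -/

variable [TopologicalSpace G]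

/-- The two properties of an amalgamated product that express that its standard graph, with vertices
the cosets of `H` and `L` and edges the cosets of `K`, is a profinite tree. -/
structure HasStandardTree (H L K : Subgroup G) : Prop where
  le_left : K ≤ H
  le_right : K ≤ L
  eq_top_of_le : ∀ (U : OpenNormalSubgroup G) (N : Subgroup G),
    H ≤ N → L ≤ N → (U : Subgroup G) ≤ N → N = ⊤
  exists_splitting : ∀ (U : OpenNormalSubgroup G) (F : Type u) [AddCommGroup F] [Finite F]
    (f : G → F), RightInvariant K f → RightInvariant (U : Subgroup G) f →
    ∃ (V : OpenNormalSubgroup G) (m : G → F), RightInvariant H m ∧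
      RightInvariant L (fun x => m x - f x) ∧ RightInvariant (V : Subgroup G) m

namespace HasStandardTree

variable {H L K : Subgroup G}

/-- This is connectedness of the graph: the period of `f` contains H, L and `U`. -/
theorem apply_eq (hT : HasStandardTree H L K) {S : Type*} (U : OpenNormalSubgroup G) {f : G → S}
    (hH : RightInvariant H f) (hL : RightInvariant L f) (hU : RightInvariant (U : Subgroup G) f)
    (x y : G) : f x = f y := by
  rw [rightInvariant_iff_le_period] at hH hL hU
  have h : x⁻¹ * y ∈ period f := by
    rw [hT.eq_top_of_le U _ hH hL hU]
    trivial
  simpa using (h x).symm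

/-- `φ` is the coboundary of the vertex function (`α`, `β`). -/
theorem exists_factor_sub (hT : HasStandardTree H L K) {p : ℕ} (U : OpenNormalSubgroup G)
    {α β : G → ZMod p} (hα : RightInvariant H α) (hβ : RightInvariant L β)
    (hαU : RightInvariant (U : Subgroup G) α) (hβU : RightInvariant (U : Subgroup G) β) :
    ∃ φ : G ⧸ (K ⊔ (U : Subgroup G)) → ZMod p, ∀ x : G, φ x = α x - β x :=
  RightInvariant.exists_factor
    (((hα.mono hT.le_left).map₂ (hβ.mono hT.le_right) fun s t => s - t).sup
      (hαU.map₂ hβU fun s t => s - t))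

/-- The pairing of a function on the edges with the chain that joins two vertices. -/
theorem sum_mul_sub (hT : HasStandardTree H L K) {p : ℕ} {U V : OpenNormalSubgroup G}
    [Fintype (G ⧸ (K ⊔ (U : Subgroup G)))] {m : G → G ⧸ (K ⊔ (U : Subgroup G)) → ZMod p}
    (hmH : RightInvariant H m)
    (hmL : RightInvariant L (fun x => m x - delta p (K ⊔ (U : Subgroup G)) x))
    (hmV : RightInvariant (V : Subgroup G) m) {α β : G → ZMod p}
    (hα : RightInvariant H α) (hβ : RightInvariant L β) (hαU : RightInvariant (U : Subgroup G) α)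
    (φ : G ⧸ (K ⊔ (U : Subgroup G)) → ZMod p) (hφ : ∀ x : G, φ x = α x - β x) (x y : G) :
    ∑ e, φ e * (m x e - m y e) = α x - α y := by
  -- Pairing `φ` with `delta x` gives `α x - β x`, so the function below can be written with `m` and
  -- `α` or with `m - delta` and `β`; it is thus constant on H-cosets and on L-cosets.
  have h := hT.apply_eq (V ⊓ U) (f := fun x => ∑ e, φ e * m x e - α x)
    (hmH.map₂ hα fun s t => ∑ e, φ e * s e - t) ?_ ?_ x y
  · simp only [mul_sub, Finset.sum_sub_distrib]
    linear_combination h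
  · have h' : (fun x => ∑ e, φ e * m x e - α x) =
        fun x => ∑ e, φ e * (m x - delta p (K ⊔ (U : Subgroup G)) x) e - β x := by
      funext x
      simp only [Pi.sub_apply, mul_sub, Finset.sum_sub_distrib, sum_mul_delta, hφ]
      ring
    rw [h']
    exact hmL.map₂ hβ fun s t => ∑ e, φ e * s e - t
  · exact (hmV.mono inf_le_left).map₂ (hαU.mono inf_le_right) fun s t => ∑ e, φ e * s e - t

/-- The chain that joins two vertices fixed by `a` is invariant under `a`. -/
theorem sub_smul (hT : HasStandardTree H L K) {p : ℕ} {U V : OpenNormalSubgroup G}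
    {m : G → G ⧸ (K ⊔ (U : Subgroup G)) → ZMod p} (hmH : RightInvariant H m)
    (hmL : RightInvariant L (fun x => m x - delta p (K ⊔ (U : Subgroup G)) x))
    (hmV : RightInvariant (V : Subgroup G) m) {a x y : G} (hx : x⁻¹ * a * x ∈ H)
    (hy : y⁻¹ * a * y ∈ H) (e : G ⧸ (K ⊔ (U : Subgroup G))) :
    m x (a • e) - m y (a • e) = m x e - m y e := by
  -- Since `delta` is equivariant, the failure of `m` to be equivariant does not depend on the
  -- vertex.
  have h := hT.apply_eq V (f := fun x => m (a * x) (a • e) - m x e)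
    ((hmH.mul_left a).map₂ hmH fun s t => s (a • e) - t e) ?_
    ((hmV.mul_left a).map₂ hmV fun s t => s (a • e) - t e) x y
  · have hfix : ∀ z, z⁻¹ * a * z ∈ H → m (a * z) = m z := by
      intro z hz
      rw [← hmH z _ hz]
      group
    simp only [hfix x hx, hfix y hy] at h
    linear_combination h
  · have h' : (fun x => m (a * x) (a • e) - m x e) =
        fun x => (m (a * x) - delta p (K ⊔ (U : Subgroup G)) (a * x)) (a • e) -
          (m x - delta p (K ⊔ (U : Subgroup G)) x) e := by
      funext x
      simp only [Pi.sub_apply, delta_smul]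
      ring
    rw [h']
    exact (hmL.mul_left a).map₂ hmL fun s t => s (a • e) - t e

end HasStandardTree

end Abstract

/-! ### Fixed points of elements of prime power order. -/

namespace HasStandardTree

variable {G : Type u} [Group G] [TopologicalSpace G] [IsTopologicalGroup G] [CompactSpace G]
  {H L K : Subgroup G}

theorem finite_quotient_sup (K : Subgroup G) (U : OpenNormalSubgroup G) :
    Finite (G ⧸ (K ⊔ (U : Subgroup G))) :=
  Subgroup.quotient_finite_of_isOpen _
    (Subgroup.isOpen_mono (le_sup_right : (U : Subgroup G) ≤ _) U.isOpen')

/-- `m` is a potential with values in edge chains: crossing the edge of `x` changes it by `delta x`,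
so `m x - m y` is a chain joining xH and yH. -/
theorem exists_chain (hT : HasStandardTree H L K) (p : ℕ) [NeZero p] (U : OpenNormalSubgroup G) :
    ∃ (V : OpenNormalSubgroup G) (m : G → G ⧸ (K ⊔ (U : Subgroup G)) → ZMod p),
      RightInvariant H m ∧
      RightInvariant L (fun x => m x - delta p (K ⊔ (U : Subgroup G)) x) ∧
      RightInvariant (V : Subgroup G) m := by
  have := finite_quotient_sup K U
  exact hT.exists_splitting U _ _ ((rightInvariant_delta p _).mono le_sup_left)
    ((rightInvariant_delta p _).mono le_sup_right)

/-- The graph of fixed points of an element of prime power order is connected: functions to `ℤ/p`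
that are invariant under the element. -/
theorem apply_eq_of_smul_invariant (hT : HasStandardTree H L K) {p k : ℕ} [Fact p.Prime]
    {U : OpenNormalSubgroup G} {a y z : G} (hy : y⁻¹ * a * y ∈ H) (hz : z⁻¹ * a * z ∈ H)
    (ha : a ^ p ^ k ∈ U) {α β : G → ZMod p} (hα : RightInvariant H α) (hβ : RightInvariant L β)
    (hαU : RightInvariant (U : Subgroup G) α) (hβU : RightInvariant (U : Subgroup G) β)
    (haα : ∀ x, α (a * x) = α x) (haβ : ∀ x, β (a * x) = β x)
    (hαβ : ∀ x, x⁻¹ * a * x ∈ K ⊔ (U : Subgroup G) → α x = β x) : α y = α z := by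
  have := finite_quotient_sup K U
  have := Fintype.ofFinite (G ⧸ (K ⊔ (U : Subgroup G)))
  obtain ⟨V, m, hmH, hmL, hmV⟩ := hT.exists_chain p U
  obtain ⟨φ, hφ⟩ := hT.exists_factor_sub U hα hβ hαU hβU
  rw [← sub_eq_zero, ← hT.sum_mul_sub hmH hmL hmV hα hβ hαU φ hφ]
  refine sum_eq_zero_of_perm_pow_eq_one (k := k) (MulAction.toPerm a) ?_ _ (fun e => ?_)
    (fun e he => ?_)
  · rw [← MulAction.toPermHom_apply, ← map_pow]
    ext e
    induction e using QuotientGroup.induction_on with | H x =>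
    refine (mk_mul_eq_iff _ _ x).2 (Subgroup.mem_sup_right ?_)
    simpa using (inferInstance : (U : Subgroup G).Normal).conj_mem _ ha x⁻¹
  · rw [MulAction.toPerm_apply, hT.sub_smul hmH hmL hmV hy hz]
    congr 1
    induction e using QuotientGroup.induction_on with | H x =>
    change φ ((a * x : G) : G ⧸ (K ⊔ (U : Subgroup G))) = _
    rw [hφ, hφ, haα, haβ]
  · induction e using QuotientGroup.induction_on with | H x =>
    rw [hφ, hαβ x ((mk_mul_eq_iff _ _ x).1 he), sub_self, zero_mul]

/-- The graph of fixed points of an element of prime power order is connected. -/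
theorem apply_eq_of_pow_mem (hT : HasStandardTree H L K) {p k : ℕ} (hp : p.Prime)
    {U : OpenNormalSubgroup G} {a y z : G} (hy : y⁻¹ * a * y ∈ H) (hz : z⁻¹ * a * z ∈ H)
    (ha : a ^ p ^ k ∈ U) {S : Type*} {α β : G → S} (hα : RightInvariant H α)
    (hβ : RightInvariant L β) (hαU : RightInvariant (U : Subgroup G) α)
    (hβU : RightInvariant (U : Subgroup G) β)
    (hαβ : ∀ x, x⁻¹ * a * x ∈ K ⊔ (U : Subgroup G) → α x = β x) : α y = α z := by
  classical
  have := Fact.mk hp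
  -- Testing the value along the whole ⟨a⟩-orbit makes the indicator invariant under `a`.
  let ind : (G → S) → G → ZMod p := fun γ x => if ∀ i : ℤ, γ (a ^ i * x) = α z then 1 else 0
  have hinv : ∀ {B : Subgroup G} {γ : G → S}, RightInvariant B γ → RightInvariant B (ind γ) := by
    intro B γ hγ x b hb
    simp only [ind, fun i : ℤ => hγ.mul_left (a ^ i) x b hb]
  have hsmul : ∀ (γ : G → S) (x : G), ind γ (a * x) = ind γ x := by
    intro γ x
    have : (∀ i : ℤ, γ (a ^ i * (a * x)) = α z) ↔ ∀ i : ℤ, γ (a ^ i * x) = α z := by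
      refine (Equiv.addRight (1 : ℤ)).forall_congr fun i => ?_
      simp only [Equiv.coe_addRight, zpow_add, zpow_one, mul_assoc]
    simp only [ind, this]
  have hz1 : ind α z = 1 := by
    refine if_pos fun i => ?_
    rw [← hα z _ (H.zpow_mem hz i)]
    congr 1
    have : (z⁻¹ * a * z) ^ i = z⁻¹ * a ^ i * z := by
      simpa only [inv_inv] using conj_zpow (a := z⁻¹) (b := a) (i := i)
    rw [this]
    group
  have h := hT.apply_eq_of_smul_invariant hy hz ha (hinv hα) (hinv hβ) (hinv hαU) (hinv hβU)
    (hsmul α) (hsmul β) fun x hx => by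
      have : ∀ i : ℤ, α (a ^ i * x) = β (a ^ i * x) := fun i => hαβ _ (by
        convert hx using 1
        group)
      simp only [ind, this]
  rw [hz1] at h
  by_contra hne
  have h0 : ind α y = 0 := if_neg fun hi => hne (by simpa using hi 0)
  rw [h0] at h
  exact zero_ne_one h

/-- If the vertices `H` and `g⁻¹ H` are distinct modulo `U`, then the intersection of their
stabilizers fixes, modulo `U`, an edge at `H`. -/
theorem exists_conj_mem_sup (hT : HasStandardTree H L K) {U : OpenNormalSubgroup G} {g : G}
    (hg : g⁻¹ ∉ H ⊔ (U : Subgroup G)) :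
    ∃ h ∈ H, ∀ a ∈ H, g * a * g⁻¹ ∈ H → h⁻¹ * a * h ∈ K ⊔ (U : Subgroup G) := by
  classical
  have := finite_quotient_sup K U
  have := Fintype.ofFinite (G ⧸ (K ⊔ (U : Subgroup G)))
  -- The chain serves only to select an edge; the coefficient prime 2 is unrelated to the primes `p`
  -- below.
  obtain ⟨V, m, hmH, hmL, hmV⟩ := hT.exists_chain 2 U
  let α : G → ZMod 2 := fun x => if x ∈ H ⊔ (U : Subgroup G) then 1 else 0
  have hα : RightInvariant (H ⊔ (U : Subgroup G)) α := fun x b hb => by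
    simp only [α, Subgroup.mul_mem_cancel_right _ hb]
  have hβ : ∀ B : Subgroup G, RightInvariant B (fun _ : G => (0 : ZMod 2)) := fun _ _ _ _ => rfl
  -- `φ` is the indicator of the edges at the vertex H modulo `U`. Its pairing with the chain is
  -- nonzero, so the chain contains such an edge.
  obtain ⟨φ, hφ⟩ := hT.exists_factor_sub U (hα.mono le_sup_left) (hβ L) (hα.mono le_sup_right)
    (hβ _)
  have hsum := hT.sum_mul_sub hmH hmL hmV (hα.mono le_sup_left) (hβ L) (hα.mono le_sup_right) φ hφ
    g⁻¹ 1
  have hα1 : α 1 = 1 := if_pos (one_mem _)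
  have hαg : α g⁻¹ = 0 := if_neg hg
  rw [hα1, hαg] at hsum
  obtain ⟨e, -, he⟩ := Finset.exists_ne_zero_of_sum_ne_zero
    (hsum.trans_ne (by decide))
  obtain ⟨hφe, hme⟩ := mul_ne_zero_iff.1 he
  induction e using QuotientGroup.induction_on with | H x =>
  have hx : x ∈ H ⊔ (U : Subgroup G) := by
    by_contra hx
    exact hφe (by rw [hφ, sub_zero]; exact if_neg hx)
  obtain ⟨h, hh, u, hu, rfl⟩ := Subgroup.mem_sup_of_normal_right.1 hx
  refine ⟨h, hh, fun a ha hga => ?_⟩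
  rw [QuotientGroup.mk_mul_of_mem h (Subgroup.mem_sup_right hu)] at hme
  set e : G ⧸ (K ⊔ (U : Subgroup G)) := (h : G ⧸ (K ⊔ (U : Subgroup G)))
  -- `m` is only known to be invariant under `V`, so fixed points are studied modulo `V ⊓ U`.
  obtain ⟨n, hn, han⟩ : ∃ n : ℕ, n ≠ 0 ∧ a ^ n ∈ ((V ⊓ U : OpenNormalSubgroup G) : Subgroup G) := by
    have := Subgroup.quotient_finite_of_isOpen _ (V ⊓ U).isOpen'
    have := Subgroup.finiteIndex_of_finite_quotient (H := (V ⊓ U).toSubgroup)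
    obtain ⟨n, hn, -, h⟩ := Subgroup.exists_pow_mem_of_index_ne_zero
      (Subgroup.FiniteIndex.index_ne_zero (H := (V ⊓ U).toSubgroup)) a
    exact ⟨n, hn.ne', h⟩
  have hconj : ∀ b, b ∈ (K ⊔ (U : Subgroup G)).comap (MulAut.conj h⁻¹).toMonoidHom ↔
      h⁻¹ * b * h ∈ K ⊔ (U : Subgroup G) := by
    simp
  rw [← hconj]
  refine mem_of_pow_mem_of_prime_pow n hn a (fun j p k hp hj => ?_) han
  rw [hconj]
  -- Cut the graph at `e`: the vertex functions `α` and `β` below agree at all edges outside `e`. If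
  -- `a ^ j` moved `e`, they would agree at all its fixed edges, and the coefficient of `e` in the
  -- chain would vanish.
  by_contra hfix
  refine hme (sub_eq_zero.2 ?_)
  have hy : (g⁻¹)⁻¹ * a ^ j * g⁻¹ ∈ H := by
    rw [inv_inv, ← conj_pow]
    exact H.pow_mem hga j
  refine hT.apply_eq_of_pow_mem hp hy (by simpa using H.pow_mem ha j) hj
    (α := fun x => m x e) (β := fun x => m x e - delta 2 _ x e)
    (hmH.comp fun t => t e) (hmL.comp fun t => t e)
    ((hmV.comp fun t => t e).mono inf_le_left) ?_ fun x hx => ?_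
  · exact (hmV.mono inf_le_left).map₂
      ((rightInvariant_delta 2 _).mono (inf_le_right.trans le_sup_right)) fun s t => s e - t e
  · rw [eq_comm, sub_eq_self]
    refine if_neg fun hxe => hfix ?_
    have hle : K ⊔ ((V ⊓ U : OpenNormalSubgroup G) : Subgroup G) ≤ K ⊔ (U : Subgroup G) :=
      sup_le_sup_left inf_le_right K
    have hx' := (mk_mul_eq_iff _ _ x).2 (hle hx)
    rw [← mk_mul_eq_iff]
    change a ^ j • e = e
    rwa [← hxe]

end HasStandardTree

/-! ### Passage to the limit over open normal subgroups. -/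

section Compactness

variable {G : Type u} [Group G] [TopologicalSpace G] [IsTopologicalGroup G]

theorem isClosed_sup (K : Subgroup G) (U : OpenNormalSubgroup G) :
    IsClosed ((K ⊔ (U : Subgroup G) : Subgroup G) : Set G) :=
  Subgroup.isClosed_of_isOpen _
    (Subgroup.isOpen_mono (le_sup_right : (U : Subgroup G) ≤ _) U.isOpen')

variable [CompactSpace G] [TotallyDisconnectedSpace G]

theorem exists_notMem_sup_of_notMem {K : Subgroup G} (hK : IsClosed (K : Set G)) {x : G}
    (hx : x ∉ K) : ∃ U : OpenNormalSubgroup G, x ∉ K ⊔ (U : Subgroup G) := by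
  obtain ⟨U, hU⟩ := ProfiniteGrp.exist_openNormalSubgroup_sub_open_nhds_of_one
    (U := (fun u : G => x * u⁻¹) ⁻¹' (K : Set G)ᶜ)
    (hK.isOpen_compl.preimage (by fun_prop)) (by simpa using hx)
  refine ⟨U, fun h => ?_⟩
  obtain ⟨k, hk, u, hu, rfl⟩ := Subgroup.mem_sup_of_normal_right.1 h
  exact hU hu (by simpa using hk)

theorem HasStandardTree.isMalnormalRelativeTo {H L K : Subgroup G} (hT : HasStandardTree H L K)
    (hH : IsClosed (H : Set G)) (hK : IsClosed (K : Set G)) : IsMalnormalRelativeTo H K := by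
  refine ⟨hT.le_left, fun g hg => ?_⟩
  obtain ⟨U₀, hU₀⟩ := exists_notMem_sup_of_notMem hH (x := g⁻¹)
    (fun h => hg (by simpa using H.inv_mem h))
  -- The `h ∈ H` whose edge hK is fixed modulo `U` by H ∩ H^g.
  let C : OpenNormalSubgroup G → Set G := fun U =>
    (H : Set G) ∩ ⋂ (a : G) (_ : a ∈ H) (_ : g * a * g⁻¹ ∈ H),
      (fun h => h⁻¹ * a * h) ⁻¹' (K ⊔ (U : Subgroup G) : Subgroup G)
  have hmem : ∀ U h, h ∈ C U ↔ h ∈ H ∧ ∀ a ∈ H, g * a * g⁻¹ ∈ H →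
      h⁻¹ * a * h ∈ K ⊔ (U : Subgroup G) := by
    intro U h
    simp [C]
  have hanti : ∀ U V : OpenNormalSubgroup G, U ≤ V → C U ⊆ C V := by
    intro U V hUV h hh
    rw [hmem] at hh ⊢
    exact ⟨hh.1, fun a ha hga => sup_le_sup_left (show (U : Subgroup G) ≤ V from hUV) K
      (hh.2 a ha hga)⟩
  have hclosed : ∀ U, IsClosed (C U) := fun U =>
    hH.inter (isClosed_iInter fun a => isClosed_iInter fun _ => isClosed_iInter fun _ =>
      (isClosed_sup K U).preimage (by fun_prop))
  have : Nonempty (OpenNormalSubgroup G) := ⟨U₀⟩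
  obtain ⟨h, hh⟩ := IsCompact.nonempty_iInter_of_directed_nonempty_isCompact_isClosed C
    (fun U V => ⟨U ⊓ V, hanti _ _ inf_le_left, hanti _ _ inf_le_right⟩)
    (fun U => by
      have hle : H ⊔ ((U ⊓ U₀ : OpenNormalSubgroup G) : Subgroup G) ≤ H ⊔ (U₀ : Subgroup G) :=
        sup_le_sup_left inf_le_right H
      obtain ⟨h, hh, hfix⟩ := hT.exists_conj_mem_sup (U := U ⊓ U₀) (fun h => hU₀ (hle h))
      exact ⟨h, hanti _ _ inf_le_left ((hmem _ _).2 ⟨hh, hfix⟩)⟩)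
    (fun U => (hclosed U).isCompact) hclosed
  simp only [Set.mem_iInter, hmem] at hh
  -- The stabilizer of hK is hKh⁻¹, which is K^(h⁻¹) in this convention.
  refine ⟨h⁻¹, H.inv_mem (hh U₀).1, fun a ha => ?_⟩
  obtain ⟨haH, hag⟩ := Subgroup.mem_inf.1 ha
  obtain ⟨d, hd, rfl⟩ := (mem_conjBy _ _ _).1 hag
  refine (mem_conjBy _ _ _).2 ⟨h⁻¹ * (g⁻¹ * d * g) * h, ?_, by group⟩
  by_contra hne
  obtain ⟨U, hU⟩ := exists_notMem_sup_of_notMem hK hne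
  refine hU ((hh U).2 _ haH ?_)
  convert hd using 1
  group

end Compactness

/-! ### The pushout has a standard tree. -/

section Pushout

variable {K H L G : ProfiniteGrp.{u}} {iH : K ⟶ H} {iL : K ⟶ L} {jH : H ⟶ G} {jL : L ⟶ G}

theorem isClosed_image {A B : ProfiniteGrp.{u}} (f : A ⟶ B) : IsClosed (image f : Set B) := by
  have : (image f : Set B) = Set.range f := rfl
  rw [this]
  exact (isCompact_range f.hom.continuous_toFun).isClosed

theorem image_comp_le {A B C : ProfiniteGrp.{u}} (f : A ⟶ B) (g : B ⟶ C) :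
    image (f ≫ g) ≤ image g := by
  rintro _ ⟨a, rfl⟩
  exact ⟨f a, rfl⟩

/-- The universal property gives a map G → N; followed by the inclusion it is the identity, by
uniqueness. -/
theorem eq_top_of_image_le (hG : IsPushout iH iL jH jL) {N : Subgroup G}
    (hN : IsClosed (N : Set G)) (hH : image jH ≤ N) (hL : image jL ≤ N) : N = ⊤ := by
  let M : ProfiniteGrp.{u} := ProfiniteGrp.ofClosedSubgroup ⟨N, hN⟩
  let ι : M ⟶ G := ConcreteCategory.ofHom (C := ProfiniteGrp)
    (⟨N.subtype, continuous_subtype_val⟩ : N →ₜ* G)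
  let rH : H ⟶ M := ConcreteCategory.ofHom (C := ProfiniteGrp)
    (⟨jH.hom.toMonoidHom.codRestrict N fun x => hH ⟨x, rfl⟩,
      jH.hom.continuous_toFun.subtype_mk _⟩ : H →ₜ* N)
  let rL : L ⟶ M := ConcreteCategory.ofHom (C := ProfiniteGrp)
    (⟨jL.hom.toMonoidHom.codRestrict N fun x => hL ⟨x, rfl⟩,
      jL.hom.continuous_toFun.subtype_mk _⟩ : L →ₜ* N)
  have hw : iH ≫ rH = iL ≫ rL := by
    ext k
    exact Subtype.ext (congrArg (fun f : K ⟶ G => f k) hG.w)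
  have hid : hG.desc rH rL hw ≫ ι = 𝟙 G := by
    refine hG.hom_ext ?_ ?_
    · rw [← Category.assoc, hG.inl_desc]
      rfl
    · rw [← Category.assoc, hG.inr_desc]
      rfl
  refine eq_top_iff.2 fun x _ => ?_
  have := congrArg (fun f : G ⟶ G => f x) hid
  have hx : N.subtype (hG.desc rH rL hw x) = x := this
  rw [← hx]
  exact Subtype.property (p := (· ∈ N)) (hG.desc rH rL hw x)

/-- The universal property of a pushout of profinite groups for homomorphisms with open kernel to
finite groups. -/
theorem exists_hom_of_isPushout (hG : IsPushout iH iL jH jL) {P : Type u} [Group P] [Finite P]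
    (ψH : H →* P) (ψL : L →* P) (hH : IsOpen (ψH.ker : Set H)) (hL : IsOpen (ψL.ker : Set L))
    (hK : ∀ k, ψH (iH k) = ψL (iL k)) :
    ∃ Φ : G →* P, IsOpen (Φ.ker : Set G) ∧ (∀ h, Φ (jH h) = ψH h) ∧ ∀ l, Φ (jL l) = ψL l := by
  let _ : TopologicalSpace P := ⊥
  have : DiscreteTopology P := ⟨rfl⟩
  have hcont : ∀ {A : ProfiniteGrp.{u}} (ψ : A →* P), IsOpen (ψ.ker : Set A) → Continuous ψ := by
    intro A ψ hψ
    refine continuous_of_continuousAt_one ψ ?_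
    rw [ContinuousAt, map_one, nhds_discrete P, Filter.tendsto_pure]
    exact hψ.mem_nhds (one_mem ψ.ker)
  let fH : H ⟶ ProfiniteGrp.of P := ConcreteCategory.ofHom (C := ProfiniteGrp)
    (⟨ψH, hcont ψH hH⟩ : H →ₜ* P)
  let fL : L ⟶ ProfiniteGrp.of P := ConcreteCategory.ofHom (C := ProfiniteGrp)
    (⟨ψL, hcont ψL hL⟩ : L →ₜ* P)
  have hw : iH ≫ fH = iL ≫ fL := by
    ext k
    exact hK k
  let Φ : G →ₜ* P := (hG.desc fH fL hw).hom
  refine ⟨Φ.toMonoidHom, ?_, fun h => ?_, fun l => ?_⟩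
  · exact (isOpen_discrete {(1 : P)}).preimage Φ.continuous_toFun
  · exact congrArg (fun f : H ⟶ ProfiniteGrp.of P => f h) (hG.inl_desc fH fL hw)
  · exact congrArg (fun f : L ⟶ ProfiniteGrp.of P => f l) (hG.inr_desc fH fL hw)

/-- Right translations of a group `Q`, acting on `Q × F`. -/
def rightTranslation (Q F : Type*) [Group Q] : Q →* Equiv.Perm (Q × F) where
  toFun q := (Equiv.mulRight q⁻¹).prodCongr (Equiv.refl F)
  map_one' := by
    ext z <;> simp
  map_mul' q r := by
    ext z <;> simp [mul_assoc]

/-- The shear of `Q × F` along a function `f : Q → F`. -/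
def shear {Q F : Type*} [AddGroup F] (f : Q → F) : Equiv.Perm (Q × F) where
  toFun z := (z.1, z.2 + f z.1)
  invFun z := (z.1, z.2 - f z.1)
  left_inv z := by simp
  right_inv z := by simp

/-- Let H act on Q × F, Q = G/U, by right translations, and L by their conjugates under the shear
along `f`. Both agree on K because `f` is K-invariant, so G acts. Take for `m x` the F-coordinate of
x⁻¹(1, 0): H preserves this coordinate, while L changes it by differences of `f`. -/
theorem exists_splitting_of_isPushout (hG : IsPushout iH iL jH jL) (U : OpenNormalSubgroup G)
    (F : Type u) [AddCommGroup F] [Finite F] (f : G → F)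
    (hfK : RightInvariant (image (iH ≫ jH)) f) (hfU : RightInvariant (U : Subgroup G) f) :
    ∃ (V : OpenNormalSubgroup G) (m : G → F), RightInvariant (image jH) m ∧
      RightInvariant (image jL) (fun x => m x - f x) ∧ RightInvariant (V : Subgroup G) m := by
  have := Subgroup.quotient_finite_of_isOpen _ U.isOpen'
  let Q := G ⧸ (U : Subgroup G)
  have : Finite Q := this
  let q : G →* Q := QuotientGroup.mk' (U : Subgroup G)
  obtain ⟨φ, hφ⟩ := hfU.exists_factor
  have hφ' : ∀ x, φ (q x) = f x := hφ
  let ρ := rightTranslation Q F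
  let s : Equiv.Perm (Q × F) := shear φ
  let ψH : H →* Equiv.Perm (Q × F) := (ρ.comp q).comp jH.hom.toMonoidHom
  let ψL : L →* Equiv.Perm (Q × F) :=
    ((MulAut.conj s).toMonoidHom.comp (ρ.comp q)).comp jL.hom.toMonoidHom
  have hopen : ∀ {A : ProfiniteGrp.{u}} (j : A ⟶ G) (σ : G →* Equiv.Perm (Q × F)),
      (U : Subgroup G) ≤ σ.ker → IsOpen ((σ.comp j.hom.toMonoidHom).ker : Set A) := by
    intro A j σ hσ
    exact (Subgroup.isOpen_mono hσ U.isOpen').preimage j.hom.continuous_toFun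
  have hq : ∀ x ∈ (U : Subgroup G), q x = 1 := fun x hx => (QuotientGroup.eq_one_iff x).2 hx
  obtain ⟨Φ, hΦ, hΦH, hΦL⟩ := exists_hom_of_isPushout hG ψH ψL
    (hopen jH (ρ.comp q) fun x hx => by
      rw [MonoidHom.mem_ker, MonoidHom.comp_apply, hq x hx, map_one])
    (hopen jL _ fun x hx => by
      rw [MonoidHom.mem_ker, MonoidHom.comp_apply, MonoidHom.comp_apply, hq x hx, map_one,
        map_one]) (fun k => by
      have hk : jL (iL k) = jH (iH k) := (congrArg (fun f : K ⟶ G => f k) hG.w).symm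
      change ρ (q (jH (iH k))) = s * ρ (q (jL (iL k))) * s⁻¹
      rw [hk, eq_mul_inv_iff_mul_eq]
      ext z
      · rfl
      · obtain ⟨x, hx⟩ := QuotientGroup.mk'_surjective (U : Subgroup G) z.1
        have hx : q x = z.1 := hx
        change z.2 + φ z.1 = z.2 + φ (z.1 * (q (jH (iH k)))⁻¹)
        rw [← hx, ← map_inv, ← map_mul, hφ', hφ']
        exact congrArg _ (hfK x _ ((image (iH ≫ jH)).inv_mem ⟨k, rfl⟩)).symm)
  have hfst : ∀ y z, (Φ y z).1 = z.1 * (q y)⁻¹ := by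
    let N : Subgroup G :=
      { carrier := {y | ∀ z, (Φ y z).1 = z.1 * (q y)⁻¹}
        one_mem' := fun z => by simp
        mul_mem' := fun {y w} hy hw z => by
          rw [map_mul, Equiv.Perm.mul_apply, hy, hw, map_mul, mul_inv_rev, mul_assoc]
        inv_mem' := fun {y} hy z => by
          have := hy (Φ y⁻¹ z)
          rw [← Equiv.Perm.mul_apply, ← map_mul, mul_inv_cancel, map_one] at this
          rw [map_inv q, inv_inv]
          exact (eq_mul_inv_iff_mul_eq.1 this).symm }
    have hN : N = ⊤ := by
      refine eq_top_of_image_le hG (N.isClosed_of_isOpen (Subgroup.isOpen_mono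
        (H₁ := Φ.ker ⊓ (U : Subgroup G)) ?_ (hΦ.inter U.isOpen'))) ?_ ?_
      · rintro y ⟨hy, hyU⟩ z
        rw [MonoidHom.mem_ker.1 hy, hq y hyU]
        simp
      · rintro _ ⟨h, rfl⟩ z
        change (Φ (jH h) z).1 = _
        rw [hΦH]
        rfl
      · rintro _ ⟨l, rfl⟩ z
        change (Φ (jL l) z).1 = _
        rw [hΦL]
        rfl
    intro y
    have : y ∈ N := hN ▸ Subgroup.mem_top y
    exact this
  refine ⟨⟨⟨Φ.ker, hΦ⟩, inferInstanceAs Φ.ker.Normal⟩, fun x => (Φ x⁻¹ (1, 0)).2, ?_, ?_, ?_⟩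
  · rintro x _ ⟨h, rfl⟩
    change (Φ (x * jH h)⁻¹ (1, 0)).2 = _
    rw [mul_inv_rev, map_mul, ← map_inv jH.hom, hΦH]
    rfl
  · rintro x _ ⟨l, rfl⟩
    change (Φ (x * jL l)⁻¹ (1, 0)).2 - f (x * jL l) = _
    have h1 : (Φ x⁻¹ (1, 0)).1 = q x := by rw [hfst, map_inv q, inv_inv, one_mul]
    rw [mul_inv_rev, map_mul, ← map_inv jL.hom, hΦL]
    change (Φ x⁻¹ (1, 0)).2 - φ (Φ x⁻¹ (1, 0)).1 +
      φ ((Φ x⁻¹ (1, 0)).1 * (q (jL l⁻¹))⁻¹) - f (x * jL l) = _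
    have h2 : (q (jL l⁻¹))⁻¹ = q (jL l) := by
      rw [map_inv jL.hom, map_inv, inv_inv]
    rw [h1, h2, ← map_mul, hφ', hφ', add_sub_cancel_right]
  · intro x v hv
    have : Φ v⁻¹ = 1 := Φ.ker.inv_mem hv
    simp only [mul_inv_rev, map_mul, this, one_mul]

theorem hasStandardTree_of_isPushout (hG : IsPushout iH iL jH jL) :
    HasStandardTree (image jH) (image jL) (image (iH ≫ jH)) where
  le_left := image_comp_le iH jH
  le_right := hG.w ▸ image_comp_le iL jL
  eq_top_of_le U N hH hL hU :=
    eq_top_of_image_le hG (N.isClosed_of_isOpen (Subgroup.isOpen_mono hU U.isOpen')) hH hL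
  exists_splitting := exists_splitting_of_isPushout hG

theorem isMalnormalRelativeTo_image_of_isPushout (hG : IsPushout iH iL jH jL) :
    IsMalnormalRelativeTo (image jH) (image (iH ≫ jH)) :=
  (hasStandardTree_of_isPushout hG).isMalnormalRelativeTo (isClosed_image _) (isClosed_image _)

end Pushout

end ProfiniteAmalgam

theorem mainTheorem7 {K H L G : ProfiniteGrp.{u}}
    (iH : K ⟶ H) (iL : K ⟶ L) (jH : H ⟶ G) (jL : L ⟶ G)
    (hG : ProfiniteAmalgam.IsAmalgamatedProduct iH iL jH jL) :
    ProfiniteAmalgam.IsMalnormalRelativeTo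
        (ProfiniteAmalgam.image jH) (ProfiniteAmalgam.image (iH ≫ jH)) ∧
      ProfiniteAmalgam.IsMalnormalRelativeTo
        (ProfiniteAmalgam.image jL) (ProfiniteAmalgam.image (iL ≫ jL)) := by
  exact ⟨ProfiniteAmalgam.isMalnormalRelativeTo_image_of_isPushout hG.isPushout,
    ProfiniteAmalgam.isMalnormalRelativeTo_image_of_isPushout hG.isPushout.flip⟩
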